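/- **Model.** There are users $1,\dots,U$, arms $1,\dots,K$ and a horizon $T$ with $T\ge K$ and $T\ge U$. An instance consists of integer costs $c_k\ge 0$ and a budget $B\in\mathbb N$ with $c_k\le B$ for every arm $k$, and a distribution $D_{u,k}$ supported on $[0,1]$ with mean $\theta_{u,k}$ for every user $u$ and arm $k$; let $\Theta=(\theta_{u,k})$. A matching $\pi:[U]\to[K]$ is feasible if $\sum_{k\in \mathrm{Im}(\pi)}c_k\le B$; $\Pi$ denotes the set of feasible matchings. In each round $t\le T$ the (possibly randomized) algorithm chooses a feasible matching $\pi_t$ based on the past matchings and observed rewards, and then observes rewards $r^t_{u,\pi_t(u)}\sim D_{u,\pi_t(u)}$ for all users $u$, drawn independently across users and rounds. The algorithm knows $U,K,T$, the costs and the budget, and that the instance is perfectly single-peaked (with respect to the identity order on the arms). Its regret is $$R_T=T\max_{\pi\in\Pi}\sum_{u}\theta_{u,\pi(u)}-\mathbb E\Big[\sum_{t=1}^T\sum_{u} r^t_{u,\pi_t(u)}\Big].$$ The instance is *perfectly single-peaked* (PSP) if for every user $u$ there is an index $p(u)\in[K]$ (a peak of $u$) with $\theta_{u,1}\le\dots\le\theta_{u,p(u)}\ge\dots\ge\theta_{u,K}$.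 In the *known peaks* setting the algorithm is also told such a function $p$; in the *unknown peaks* setting it is not. **Theorem.** There is a universal constant $c>0$ such that the following holds. 1. (Known peaks.) Let $U\ge 2$ and $T\ge\max\{U,K\}$. For every algorithm in the known peaks setting, the worst-case regret over PSP instances with $U$ users and $K$ arms is - at least $c\,\max\{U\sqrt T,\sqrt{TK}\}$ if $K\ge 3$ and $K^3\le T$; - at least $c\,U\sqrt T$ if $K\ge 3$ (with no further restriction on $K$); - at least $c\,\sqrt{TK}$ if $K\ge 2$ and $K^3\le T$. 2. (Unknown peaks.) Let $U\ge 1$, $K\ge 2$ and $T\ge\max\{U,K\}$. For every algorithm in the unknown peaks setting, the worst-case regret over PSP instances with $U$ users and $K$ arms is at least $c\,U\sqrt{TK}$. Here "the worst-case regret is at least $x$" means that some PSP instance (together with some peak function $p$ of it that is revealed to the algorithm, in the known peaks setting) has $R_T\ge x$. -/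

import Mathlib

open MeasureTheory ProbabilityTheory

noncomputable section

namespace CBR

/-- The publicly known part of a problem with `K` arms: arm costs and a per-round budget,
where every single arm is affordable. -/
structure Market (K : ℕ) where
  cost : Fin K → ℕ
  budget : ℕ
  cost_le : ∀ k, cost k ≤ budget

/-- A matching assigns one arm to each user. -/
abbrev Matching (U K : ℕ) : Type := Fin U → Fin K

/-- A matching is feasible if the total cost of the arms in its image is within the budget. -/
def Market.Feasible {U K : ℕ} (M : Market K) (π : Matching U K) : Prop :=
  ∑ k ∈ Finset.univ.image π, M.cost k ≤ M.budget

/-- An instance: a market together with reward distributions on `[0,1]`,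
one for every pair of a user and an arm. -/
structure Instance (U K : ℕ) extends Market K where
  D : Fin U → Fin K → Measure ℝ
  isProbabilityMeasure : ∀ u k, IsProbabilityMeasure (D u k)
  support : ∀ u k, ∀ᵐ x ∂(D u k), x ∈ Set.Icc (0 : ℝ) 1

/-- The expected reward matrix `Θ`. -/
def Instance.Θ {U K : ℕ} (I : Instance U K) : Matrix (Fin U) (Fin K) ℝ :=
  fun u k => ∫ x, x ∂(I.D u k)

/-- The value of a matching under an expected reward matrix. -/
def value {U K : ℕ} (Θ : Matrix (Fin U) (Fin K) ℝ) (π : Matching U K) : ℝ :=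
  ∑ u, Θ u (π u)

/-- `p u` is a peak of row `u` for every user `u`: the row is nondecreasing up to the index `p u`
and nonincreasing from it on. -/
def HasPeaks {U K : ℕ} (Θ : Matrix (Fin U) (Fin K) ℝ) (p : Fin U → Fin K) : Prop :=
  ∀ u, MonotoneOn (Θ u) (Set.Iic (p u)) ∧ AntitoneOn (Θ u) (Set.Ici (p u))

/-- Perfectly single-peaked matrices. -/
def IsPSP {U K : ℕ} (Θ : Matrix (Fin U) (Fin K) ℝ) : Prop :=
  ∃ p : Fin U → Fin K, HasPeaks Θ p

/-- What is recorded in one round: the matching played and the observed reward of each user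
(semi-bandit feedback). -/
abbrev Round (U K : ℕ) : Type := Matching U K × (Fin U → ℝ)

/-- The history of the first `t` rounds. -/
abbrev History (U K t : ℕ) : Type := Fin t → Round U K

/-- A (possibly randomized) policy for a given market: given the history of the first `t` rounds, a
probability distribution on matchings, concentrated on the feasible ones. -/
structure Policy (U : ℕ) {K : ℕ} (M : Market K) where
  kernel : (t : ℕ) → Kernel (History U K t) (Matching U K)
  isMarkovKernel : ∀ t, IsMarkovKernel (kernel t)
  feasible : ∀ t h, ∀ᵐ π ∂(kernel t h), M.Feasible π

/-- The joint law of the observed rewards, given the matching played in the round: the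
rewards of different users are independent. -/
def Instance.rewardKernel {U K : ℕ} (I : Instance U K) :
    Kernel (Matching U K) (Fin U → ℝ) where
  toFun π := Measure.pi fun u => I.D u (π u)
  measurable' := measurable_of_countable _

instance {U K : ℕ} (I : Instance U K) : IsMarkovKernel I.rewardKernel where
  isProbabilityMeasure π := by
    have := fun u => I.isProbabilityMeasure u (π u)
    change IsProbabilityMeasure (Measure.pi fun u => I.D u (π u))
    infer_instance

/-- The conditional law of the next round given the history: the policy draws a matching
from its distribution, then the rewards are drawn afresh. -/
def Instance.roundKernel {U K : ℕ} (I : Instance U K) (A : Policy U I.toMarket) (t : ℕ) :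
    Kernel (History U K t) (Round U K) :=
  A.kernel t ⊗ₖ Kernel.prodMkLeft (History U K t) I.rewardKernel

instance {U K : ℕ} (I : Instance U K) (A : Policy U I.toMarket) (t : ℕ) :
    IsMarkovKernel (I.roundKernel A t) := by
  have := A.isMarkovKernel t
  unfold Instance.roundKernel
  infer_instance

/-- The law of the history of the first `t` rounds of a policy playing on an instance. -/
def Instance.historyLaw {U K : ℕ} (I : Instance U K) (A : Policy U I.toMarket) :
    (t : ℕ) → Measure (History U K t)
  | 0 => Measure.dirac Fin.elim0
  | t + 1 => ((I.historyLaw A t) ⊗ₘ (I.roundKernel A t)).map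
      fun x => (Fin.snoc x.1 x.2 : History U K (t + 1))

theorem measurable_snoc (U K t : ℕ) :
    Measurable fun x : History U K t × Round U K => (Fin.snoc x.1 x.2 : History U K (t + 1)) := by
  refine measurable_pi_lambda _ fun i => ?_
  refine Fin.lastCases ?_ (fun j => ?_) i
  · simpa using measurable_snd
  · simp only [Fin.snoc_castSucc]
    exact (measurable_pi_apply j).comp measurable_fst

instance {U K : ℕ} (I : Instance U K) (A : Policy U I.toMarket) (t : ℕ) :
    IsProbabilityMeasure (I.historyLaw A t) := by
  induction t with
  | zero => exact Measure.dirac.isProbabilityMeasure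
  | succ t ih => exact Measure.isProbabilityMeasure_map (measurable_snoc U K t).aemeasurable

/-- The expected regret over `T` rounds. -/
def Instance.regret {U K : ℕ} (I : Instance U K) (A : Policy U I.toMarket) (T : ℕ) : ℝ :=
  T * (⨆ π : {π : Matching U K // I.Feasible π}, value I.Θ π.1) -
    ∫ h, ∑ t : Fin T, ∑ u : Fin U, (h t).2 u ∂(I.historyLaw A T)

/-- An algorithm that is told the costs, the budget and the peak of every user. (It also knows that
the identity order is a single-peaked order, as all instances it is run on are PSP.) -/
abbrev KnownPeaksAlgorithm (U K : ℕ) : Type :=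
  (M : Market K) → (Fin U → Fin K) → Policy U M

/-- An algorithm that is told the costs and the budget, but not the peaks. -/
abbrev UnknownPeaksAlgorithm (U K : ℕ) : Type :=
  (M : Market K) → Policy U M

/-- With known peaks, the worst-case regret of `A` over PSP instances after `T` rounds
is at least `x`. -/
def KnownPeaksWorstCaseRegretGE {U K : ℕ} (A : KnownPeaksAlgorithm U K) (T : ℕ) (x : ℝ) : Prop :=
  ∃ (I : Instance U K) (p : Fin U → Fin K), HasPeaks I.Θ p ∧ x ≤ I.regret (A I.toMarket p) T

/-- With unknown peaks, the worst-case regret of `A` over PSP instances after `T` rounds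
is at least `x`. -/
def UnknownPeaksWorstCaseRegretGE {U K : ℕ} (A : UnknownPeaksAlgorithm U K) (T : ℕ) (x : ℝ) :
    Prop :=
  ∃ I : Instance U K, IsPSP I.Θ ∧ x ≤ I.regret (A I.toMarket) T

end CBR

end

/-! All three bounds come from one bandit argument. Take Bernoulli rewards with a base matrix `θ`, a
set `S` of users and a set `Opt` of `N` arms, and for every `u ∈ S` raise the mean of one secret arm
`j u ∈ Opt` by `ε`. If some feasible matching gives each `u ∈ S` its secret arm and also maximizes
the base value, each user of `S` who is off the secret arm costs `ε` in that round
(`exists_le_regret`).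

Users can be treated separately. Fix the secret arms of all users but `u`, and compare with the
instance where `u` has no raised arm. The two laws of the history have divergence O(ε²) times the
expected number of times `u` plays the raised arm (`playLaw_real_le`). These counts sum to at most
`T` over `Opt`, so for ε² of order N/T an average choice of `j` leaves `u` off the secret arm at
least a quarter of the time (`exists_many_mistakes`). With ε = √(N/T)/20 the regret is at least
|S|√(TN)/80.

It remains to choose base instances that stay single-peaked after raising, with peaks that do not
reveal `j` when they are known. With unknown peaks, constant rows and free arms suffice, and the
raised arm is the peak. With known peaks the budget prevents users from sitting at their peaks:
either it pays for one arm only, shared by two users with opposite monotone rows, or it pays for two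
arms on either side of the peak of half of the users, while the others want one of those two. -/

noncomputable section

/-! ### Densities of product measures, and probabilities under a change of measure. -/

namespace MeasureTheory

open scoped ENNReal

theorem lintegral_pi_prod {ι : Type*} [Fintype ι] {X : ι → Type*} [∀ i, MeasurableSpace (X i)]
    (μ : ∀ i, Measure (X i)) [∀ i, IsProbabilityMeasure (μ i)] {g : ∀ i, X i → ℝ≥0∞}
    (hg : ∀ i, Measurable (g i)) :
    ∫⁻ x, ∏ i, g i (x i) ∂Measure.pi μ = ∏ i, ∫⁻ x, g i x ∂μ i := by
  have hind : iIndepFun (fun i (x : ∀ i, X i) => g i (x i)) (Measure.pi μ) :=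
    iIndepFun_pi fun i => (hg i).aemeasurable
  rw [lintegral_prod_eq_prod_lintegral_of_indepFun Finset.univ _ hind
    fun i => (hg i).comp (measurable_pi_apply i)]
  refine Finset.prod_congr rfl fun i _ => ?_
  rw [← (measurePreserving_eval μ i).map_eq, lintegral_map (hg i) (measurable_pi_apply i)]

theorem pi_withDensity {ι : Type*} [Fintype ι] {X : ι → Type*} [∀ i, MeasurableSpace (X i)]
    (μ : ∀ i, Measure (X i)) [∀ i, IsProbabilityMeasure (μ i)] {g : ∀ i, X i → ℝ≥0∞}
    (hg : ∀ i, Measurable (g i)) [∀ i, SigmaFinite ((μ i).withDensity (g i))] :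
    Measure.pi (fun i => (μ i).withDensity (g i)) =
      (Measure.pi μ).withDensity fun x => ∏ i, g i (x i) := by
  refine Measure.pi_eq fun s hs => ?_
  rw [withDensity_apply _ (MeasurableSet.univ_pi hs), ← lintegral_indicator
    (MeasurableSet.univ_pi hs)]
  have : (Set.univ.pi s).indicator (fun x : ∀ i, X i => ∏ i, g i (x i)) =
      fun x => ∏ i, (s i).indicator (g i) (x i) := by
    ext x
    by_cases hx : x ∈ Set.univ.pi s
    · rw [Set.indicator_of_mem hx]
      exact Finset.prod_congr rfl fun i _ =>
        (Set.indicator_of_mem (hx i (Set.mem_univ i)) _).symm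
    · rw [Set.indicator_of_notMem hx]
      simp only [Set.mem_univ_pi, not_forall] at hx
      obtain ⟨i, hi⟩ := hx
      exact (Finset.prod_eq_zero (Finset.mem_univ i) (Set.indicator_of_notMem hi _)).symm
  rw [this, lintegral_pi_prod μ fun i => (hg i).indicator (hs i)]
  refine Finset.prod_congr rfl fun i _ => ?_
  rw [withDensity_apply _ (hs i), lintegral_indicator (hs i)]

/-- The probability of an event changes little under a change of measure whose
Kullback-Leibler divergence `-∫ Λ` is small. -/
theorem measureReal_withDensity_exp_le {Ω : Type*} [MeasurableSpace Ω] {P : Measure Ω}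
    [IsProbabilityMeasure P] {Λ : Ω → ℝ} (hΛ : Measurable Λ) (hint : Integrable Λ P)
    [IsProbabilityMeasure (P.withDensity fun x => ENNReal.ofReal (Real.exp (Λ x)))]
    {E : Set Ω} (hE : MeasurableSet E) :
    (P.withDensity fun x => ENNReal.ofReal (Real.exp (Λ x))).real E ≤
      P.real E + 8 * (-∫ x, Λ x ∂P) + 1 / 8 := by
  have hL : ∫⁻ x, ENNReal.ofReal (Real.exp (Λ x)) ∂P = 1 := by
    rw [← setLIntegral_univ, ← withDensity_apply _ MeasurableSet.univ, measure_univ]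
  have hLm : Measurable fun x => Real.exp (Λ x) := hΛ.exp
  have hLi : Integrable (fun x => Real.exp (Λ x)) P := by
    refine ⟨hLm.aestronglyMeasurable, ?_⟩
    rw [hasFiniteIntegral_iff_ofReal (Filter.Eventually.of_forall fun x => (Real.exp_pos _).le), hL]
    exact ENNReal.one_lt_top
  have hL1 : ∫ x, Real.exp (Λ x) ∂P = 1 := by
    rw [integral_eq_lintegral_of_nonneg_ae (Filter.Eventually.of_forall
      fun x => (Real.exp_pos _).le) hLm.aestronglyMeasurable, hL, ENNReal.toReal_one]
  have hEv : (P.withDensity fun x => ENNReal.ofReal (Real.exp (Λ x))).real E =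
      ∫ x in E, Real.exp (Λ x) ∂P := by
    rw [measureReal_def, withDensity_apply _ hE, integral_eq_lintegral_of_nonneg_ae
      (Filter.Eventually.of_forall fun x => (Real.exp_pos _).le) hLm.aestronglyMeasurable]
  -- With s = exp(Λ/2), weighted AM-GM gives s² - 1 = (s-1)(s+1) ≤ 8(s-1)² + (s+1)²/32. Here (s-1)²
  -- ≤ exp Λ - 1 - Λ because s ≥ 1 + Λ/2, and (s+1)² ≤ 2(s²+1). So exp Λ ≤ 1 + `G`, and `G`
  -- integrates to 8 times the divergence plus 1/8.
  set G : Ω → ℝ := fun x => 8 * (Real.exp (Λ x) - 1 - Λ x) + (Real.exp (Λ x) + 1) / 16 with hG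
  have hGi : Integrable G P :=
    (((hLi.sub (integrable_const 1)).sub hint).const_mul 8).add
      ((hLi.add (integrable_const 1)).div_const 16)
  have hG0 : ∀ x, 0 ≤ G x := fun x => by
    have := Real.add_one_le_exp (Λ x)
    have := Real.exp_pos (Λ x)
    simp only [hG]
    linarith
  have hle : ∀ x, Real.exp (Λ x) ≤ 1 + G x := fun x => by
    have h1 := Real.add_one_le_exp (Λ x / 2)
    have h2 : Real.exp (Λ x) = Real.exp (Λ x / 2) ^ 2 := by
      rw [← Real.exp_nat_mul]
      congr 1
      push_cast
      ring
    simp only [hG]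
    rw [h2]
    set s := Real.exp (Λ x / 2)
    nlinarith [sq_nonneg (16 * (s - 1) - (s + 1)), sq_nonneg (s - 1), sq_nonneg (s + 1)]
  have hGint : ∫ x, G x ∂P = 8 * (-∫ x, Λ x ∂P) + 1 / 8 := by
    have hG' : G = fun x => (8 + 1 / 16) * Real.exp (Λ x) - 8 * Λ x - (8 - 1 / 16) := by
      ext x
      simp only [hG]
      ring
    have h1 : Integrable (fun x => (8 + 1 / 16) * Real.exp (Λ x)) P := hLi.const_mul _
    have h2 : Integrable (fun x => 8 * Λ x) P := hint.const_mul _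
    have h3 : Integrable (fun x => (8 + 1 / 16) * Real.exp (Λ x) - 8 * Λ x) P := h1.sub h2
    rw [hG', integral_sub h3 (integrable_const _), integral_sub h1 h2, integral_const_mul,
      integral_const_mul, hL1, integral_const, probReal_univ]
    norm_num
    ring
  calc (P.withDensity fun x => ENNReal.ofReal (Real.exp (Λ x))).real E
      = ∫ x in E, Real.exp (Λ x) ∂P := hEv
    _ ≤ ∫ x in E, (1 + G x) ∂P :=
        setIntegral_mono hLi.integrableOn ((integrable_const 1).add hGi).integrableOn hle
    _ = P.real E + ∫ x in E, G x ∂P := by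
        rw [integral_add (integrable_const 1).integrableOn hGi.integrableOn]
        simp
    _ ≤ P.real E + ∫ x, G x ∂P := by
        refine add_le_add_right ?_ _
        exact setIntegral_le_integral hGi (Filter.Eventually.of_forall hG0)
    _ = _ := by rw [hGint]; ring

end MeasureTheory

namespace CBR

open scoped ENNReal

variable {U K : ℕ}

attribute [instance] Instance.isProbabilityMeasure Policy.isMarkovKernel

/-! ### The law of the history: single rounds, additive functionals, likelihood ratios. -/

theorem Instance.lintegral_roundKernel (I : Instance U K) (A : Policy U I.toMarket) (t : ℕ)
    (h : History U K t) {g : Round U K → ℝ≥0∞} (hg : Measurable g) :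
    ∫⁻ x, g x ∂I.roundKernel A t h =
      ∫⁻ π, ∫⁻ r, g (π, r) ∂I.rewardKernel π ∂A.kernel t h := by
  rw [Instance.roundKernel, Kernel.lintegral_compProd _ _ _ hg]
  rfl

theorem Instance.lintegral_historyLaw_succ (I : Instance U K) (A : Policy U I.toMarket) (t : ℕ)
    {f : History U K (t + 1) → ℝ≥0∞} (hf : Measurable f) :
    ∫⁻ h, f h ∂I.historyLaw A (t + 1) =
      ∫⁻ h, ∫⁻ π, ∫⁻ r, f (Fin.snoc h (π, r) : History U K (t + 1)) ∂I.rewardKernel π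
        ∂A.kernel t h ∂I.historyLaw A t := by
  have hs := hf.comp (measurable_snoc U K t)
  rw [Instance.historyLaw, lintegral_map hf (measurable_snoc U K t),
    ← Function.comp_def f, Measure.lintegral_compProd hs]
  exact lintegral_congr fun h => I.lintegral_roundKernel A t h (hs.comp measurable_prodMk_left)

/-- Once the matching of round `s` is drawn, its rewards are fresh, and later rounds integrate to
mass one. -/
theorem Instance.lintegral_round (I : Instance U K) :
    ∀ (T : ℕ) (A : Policy U I.toMarket) (s : Fin T) {g : Round U K → ℝ≥0∞}, Measurable g →
      ∫⁻ h, g (h s) ∂I.historyLaw A T =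
        ∫⁻ h, ∫⁻ r, g ((h s).1, r) ∂I.rewardKernel (h s).1 ∂I.historyLaw A T := by
  intro T
  induction T with
  | zero => exact fun _ s => s.elim0
  | succ t ih =>
    intro A s g hg
    have hg' : Measurable fun π : Matching U K => ∫⁻ r, g (π, r) ∂I.rewardKernel π :=
      measurable_of_countable _
    rw [I.lintegral_historyLaw_succ A t (f := fun h => g (h s)) (hg.comp (measurable_pi_apply s)),
      I.lintegral_historyLaw_succ A t
        (f := fun h => ∫⁻ r, g ((h s).1, r) ∂I.rewardKernel (h s).1)
        (hg'.comp (measurable_fst.comp (measurable_pi_apply s)))]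
    refine Fin.lastCases ?_ (fun s => ?_) s
    · simp
    · simpa using ih A s hg

/-- The law of the matching played in round `s`. -/
def Instance.playLaw (I : Instance U K) {T : ℕ} (A : Policy U I.toMarket) (s : Fin T) :
    Measure (Matching U K) :=
  (I.historyLaw A T).map fun h => (h s).1

theorem measurable_play {T : ℕ} (s : Fin T) :
    Measurable fun h : History U K T => (h s).1 :=
  measurable_fst.comp (measurable_pi_apply s)

instance (I : Instance U K) {T : ℕ} (A : Policy U I.toMarket) (s : Fin T) :
    IsProbabilityMeasure (I.playLaw A s) :=
  Measure.isProbabilityMeasure_map (measurable_play s).aemeasurable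

/-- Regret and log-likelihood ratio are both sums over rounds, so their expectations need only this
marginal and not the dependence between rounds. -/
theorem Instance.map_round (I : Instance U K) {T : ℕ} (A : Policy U I.toMarket) (s : Fin T) :
    (I.historyLaw A T).map (fun h => h s) = I.playLaw A s ⊗ₘ I.rewardKernel := by
  refine Measure.ext_of_lintegral _ fun g hg => ?_
  rw [lintegral_map hg (measurable_pi_apply s), I.lintegral_round T A s hg,
    Measure.lintegral_compProd hg, Instance.playLaw,
    lintegral_map (measurable_of_countable _) (measurable_play s)]

theorem Instance.integrable_round (I : Instance U K) {T : ℕ} (A : Policy U I.toMarket)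
    (s : Fin T) {g : Round U K → ℝ} (hg : Measurable g)
    (hi : ∀ π, Integrable (fun r => g (π, r)) (I.rewardKernel π)) :
    Integrable (fun h => g (h s)) (I.historyLaw A T) := by
  have : Integrable g ((I.historyLaw A T).map fun h => h s) := by
    rw [I.map_round, Measure.integrable_compProd_iff hg.aestronglyMeasurable]
    exact ⟨Filter.Eventually.of_forall hi, Integrable.of_finite⟩
  exact this.comp_measurable (measurable_pi_apply s)

theorem Instance.integral_round (I : Instance U K) {T : ℕ} (A : Policy U I.toMarket)
    (s : Fin T) {g : Round U K → ℝ} (hg : Measurable g)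
    (hi : ∀ π, Integrable (fun r => g (π, r)) (I.rewardKernel π)) :
    ∫ h, g (h s) ∂I.historyLaw A T = ∫ π, ∫ r, g (π, r) ∂I.rewardKernel π ∂I.playLaw A s := by
  rw [← integral_map (φ := fun h : History U K T => h s) (measurable_pi_apply s).aemeasurable
    hg.aestronglyMeasurable, I.map_round, Measure.integral_compProd]
  rw [Measure.integrable_compProd_iff hg.aestronglyMeasurable]
  exact ⟨Filter.Eventually.of_forall hi, Integrable.of_finite⟩

/-- Integration over one round of a sum, over the users, of functions of the own arm and
reward. -/
theorem Instance.integrable_reward_sum (I : Instance U K) {f : Fin U → Fin K → ℝ → ℝ}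
    (hi : ∀ u k, Integrable (f u k) (I.D u k)) (π : Matching U K) :
    Integrable (fun r => ∑ u, f u (π u) (r u)) (I.rewardKernel π) :=
  integrable_finsetSum _ fun u _ =>
    integrable_comp_eval (μ := fun u => I.D u (π u)) (hi u (π u))

theorem Instance.integral_reward_sum (I : Instance U K) {f : Fin U → Fin K → ℝ → ℝ}
    (hi : ∀ u k, Integrable (f u k) (I.D u k)) (π : Matching U K) :
    ∫ r, ∑ u, f u (π u) (r u) ∂I.rewardKernel π = ∑ u, ∫ x, f u (π u) x ∂I.D u (π u) := by
  rw [integral_finsetSum]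
  · exact Finset.sum_congr rfl fun u _ =>
      integral_comp_eval (μ := fun u => I.D u (π u)) (hi u (π u)).aestronglyMeasurable
  · exact fun u _ => integrable_comp_eval (μ := fun u => I.D u (π u)) (hi u (π u))

theorem measurable_round_sum {f : Fin U → Fin K → ℝ → ℝ} (hf : ∀ u k, Measurable (f u k)) :
    Measurable fun x : Round U K => ∑ u, f u (x.1 u) (x.2 u) := by
  refine measurable_from_prod_countable_right fun π => ?_
  exact Finset.measurable_sum _ fun u _ => (hf u (π u)).comp (measurable_pi_apply u)

/-- The expectation of an additive functional of the history. -/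
theorem Instance.integral_history_sum (I : Instance U K) {T : ℕ} (A : Policy U I.toMarket)
    {f : Fin U → Fin K → ℝ → ℝ} (hf : ∀ u k, Measurable (f u k))
    (hi : ∀ u k, Integrable (f u k) (I.D u k)) :
    ∫ h, ∑ t : Fin T, ∑ u, f u ((h t).1 u) ((h t).2 u) ∂I.historyLaw A T =
      ∑ t : Fin T, ∫ π, ∑ u, ∫ x, f u (π u) x ∂I.D u (π u) ∂I.playLaw A t := by
  have hint := I.integrable_reward_sum hi
  rw [integral_finsetSum _ fun t _ => I.integrable_round A t (measurable_round_sum hf) hint]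
  refine Finset.sum_congr rfl fun t _ => ?_
  rw [I.integral_round A t (measurable_round_sum hf) hint]
  exact integral_congr_ae (Filter.Eventually.of_forall fun π => I.integral_reward_sum hi π)

theorem Instance.integrable_history_sum (I : Instance U K) {T : ℕ} (A : Policy U I.toMarket)
    {f : Fin U → Fin K → ℝ → ℝ} (hf : ∀ u k, Measurable (f u k))
    (hi : ∀ u k, Integrable (f u k) (I.D u k)) :
    Integrable (fun h => ∑ t : Fin T, ∑ u, f u ((h t).1 u) ((h t).2 u)) (I.historyLaw A T) :=
  integrable_finsetSum _ fun t _ =>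
    I.integrable_round A t (measurable_round_sum hf) (I.integrable_reward_sum hi)

/-- Change of measure for a policy playing on two instances with mutually absolutely
continuous reward distributions. -/
theorem Instance.historyLaw_eq_withDensity (I I' : Instance U K) (A : Policy U I.toMarket)
    (A' : Policy U I'.toMarket) (hA : A'.kernel = A.kernel) {lr : Fin U → Fin K → ℝ → ℝ}
    (hlr : ∀ u k, Measurable (lr u k))
    (hD : ∀ u k, I'.D u k = (I.D u k).withDensity fun x => ENNReal.ofReal (Real.exp (lr u k x)))
    (T : ℕ) :
    I'.historyLaw A' T = (I.historyLaw A T).withDensity fun h =>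
      ENNReal.ofReal (Real.exp (∑ t, ∑ u, lr u ((h t).1 u) ((h t).2 u))) := by
  have hrew : ∀ π, I'.rewardKernel π = (I.rewardKernel π).withDensity fun r =>
      ENNReal.ofReal (Real.exp (∑ u, lr u (π u) (r u))) := by
    intro π
    have hp : ∀ u, IsProbabilityMeasure
        ((I.D u (π u)).withDensity fun x => ENNReal.ofReal (Real.exp (lr u (π u) x))) := by
      intro u
      rw [← hD]
      infer_instance
    change Measure.pi (fun u => I'.D u (π u)) = (Measure.pi fun u => I.D u (π u)).withDensity _
    simp_rw [hD]
    rw [pi_withDensity (fun u => I.D u (π u))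
      (g := fun u x => ENNReal.ofReal (Real.exp (lr u (π u) x)))
      fun u => (hlr u (π u)).exp.ennreal_ofReal]
    congr 1
    ext r
    rw [Real.exp_sum, ENNReal.ofReal_prod_of_nonneg fun _ _ => (Real.exp_pos _).le]
  have hround := measurable_round_sum hlr
  have hhist : ∀ t, Measurable fun h : History U K t =>
      ENNReal.ofReal (Real.exp (∑ t, ∑ u, lr u ((h t).1 u) ((h t).2 u))) := fun t =>
    (Finset.measurable_sum _ fun s _ =>
      hround.comp (measurable_pi_apply s)).exp.ennreal_ofReal
  -- One more round multiplies the density by the likelihood ratio of its rewards only: the matching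
  -- is drawn from the same kernel on both sides.
  induction T with
  | zero =>
    simp [Instance.historyLaw]
  | succ t ih =>
    refine Measure.ext_of_lintegral _ fun f hf => ?_
    have hs := measurable_snoc U K t
    have hf' : ∀ (h : History U K t) (π : Matching U K),
        Measurable fun r : Fin U → ℝ => f (Fin.snoc h (π, r) : History U K (t + 1)) := fun h π =>
      (hf.comp hs).comp (measurable_const.prodMk (measurable_const.prodMk measurable_id))
    have hround' : ∀ π : Matching U K, Measurable fun r : Fin U → ℝ =>
        ENNReal.ofReal (Real.exp (∑ u, lr u (π u) (r u))) := fun π =>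
      (hround.comp (measurable_const.prodMk measurable_id)).exp.ennreal_ofReal
    rw [lintegral_withDensity_eq_lintegral_mul _ (hhist _) hf,
      I.lintegral_historyLaw_succ A t ((hhist _).mul hf), I'.lintegral_historyLaw_succ A' t hf, ih,
      lintegral_withDensity_eq_lintegral_mul _ (hhist t), hA]
    · refine lintegral_congr fun h => ?_
      simp only [Pi.mul_apply]
      rw [← lintegral_const_mul _ (measurable_of_countable _)]
      refine lintegral_congr fun π => ?_
      rw [hrew, lintegral_withDensity_eq_lintegral_mul _ (hround' π) (hf' h π),
        ← lintegral_const_mul _ ((hround' π).mul (hf' h π))]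
      refine lintegral_congr fun r => ?_
      simp only [Pi.mul_apply, Fin.sum_univ_castSucc, Fin.snoc_castSucc, Fin.snoc_last]
      rw [Real.exp_add, ENNReal.ofReal_mul (Real.exp_pos _).le, mul_assoc]
    · have hm : Measurable fun h => ∫⁻ x, f (Fin.snoc h x : History U K (t + 1))
          ∂I'.roundKernel A' t h :=
        Measurable.lintegral_kernel_prod_right
          (f := fun h x => f (Fin.snoc h x : History U K (t + 1))) (hf.comp hs)
      convert hm using 2 with h
      exact (I'.lintegral_roundKernel A' t h ((hf.comp hs).comp measurable_prodMk_left)).symm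

/-! ### Regret as a sum of losses of single rounds. -/

theorem Instance.playLaw_feasible (I : Instance U K) :
    ∀ (T : ℕ) (A : Policy U I.toMarket) (s : Fin T), ∀ᵐ π ∂I.playLaw A s, I.Feasible π := by
  suffices h : ∀ (T : ℕ) (A : Policy U I.toMarket) (s : Fin T),
      ∫⁻ h, {π : Matching U K | ¬ I.Feasible π}.indicator (1 : Matching U K → ℝ≥0∞) (h s).1
        ∂I.historyLaw A T = 0 by
    intro T A s
    have hm : MeasurableSet {π : Matching U K | ¬ I.Feasible π} := Set.Countable.measurableSet
      (Set.to_countable _)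
    rw [ae_iff, ← lintegral_indicator_one hm, Instance.playLaw,
      lintegral_map (measurable_of_countable _) (measurable_play s), h T A s]
  intro T
  induction T with
  | zero => exact fun _ s => s.elim0
  | succ t ih =>
    intro A s
    have hg : Measurable ({π : Matching U K | ¬ I.Feasible π}.indicator (1 : Matching U K → ℝ≥0∞)) :=
      measurable_of_countable _
    rw [I.lintegral_historyLaw_succ A t
      (f := fun h => {π : Matching U K | ¬ I.Feasible π}.indicator (1 : Matching U K → ℝ≥0∞)
        (h s).1) (hg.comp (measurable_play s))]
    refine Fin.lastCases ?_ (fun s => ?_) s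
    · simp only [Fin.snoc_last, lintegral_const, measure_univ, mul_one]
      refine (lintegral_congr fun h => ?_).trans (lintegral_zero (μ := I.historyLaw A t))
      rw [lintegral_indicator_one (Set.to_countable _).measurableSet, ← ae_iff]
      exact A.feasible t h
    · simpa using ih A s

theorem Instance.integrable_reward (I : Instance U K) (u : Fin U) (k : Fin K) :
    Integrable (fun x => x) (I.D u k) :=
  Integrable.of_mem_Icc 0 1 aemeasurable_id (I.support u k)

theorem Instance.regret_eq (I : Instance U K) (A : Policy U I.toMarket) (T : ℕ) :
    I.regret A T = T * (⨆ π : {π : Matching U K // I.Feasible π}, value I.Θ π.1) -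
      ∑ t : Fin T, ∫ π, value I.Θ π ∂I.playLaw A t := by
  rw [Instance.regret, I.integral_history_sum A (f := fun _ _ x => x) (fun _ _ => measurable_id)
    I.integrable_reward]
  rfl

/-- `g` bounds from below the loss of a round against the benchmark `π₀`. Since plays are almost
surely feasible, the loss needs to be controlled on feasible matchings only. -/
theorem Instance.le_regret (I : Instance U K) (A : Policy U I.toMarket) (T : ℕ)
    {g : Matching U K → ℝ} {π₀ : Matching U K} (h₀ : I.Feasible π₀)
    (hg : ∀ π, I.Feasible π → value I.Θ π + g π ≤ value I.Θ π₀) :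
    ∑ t : Fin T, ∫ π, g π ∂I.playLaw A t ≤ I.regret A T := by
  rw [I.regret_eq]
  have hsup : value I.Θ π₀ ≤ ⨆ π : {π : Matching U K // I.Feasible π}, value I.Θ π.1 :=
    le_ciSup (f := fun π : {π : Matching U K // I.Feasible π} => value I.Θ π.1)
      (Set.finite_range _).bddAbove ⟨π₀, h₀⟩
  have hround : ∀ t : Fin T, ∫ π, g π ∂I.playLaw A t + ∫ π, value I.Θ π ∂I.playLaw A t ≤
      value I.Θ π₀ := fun t => by
    rw [← integral_add .of_finite .of_finite]
    calc ∫ π, (g π + value I.Θ π) ∂I.playLaw A t ≤ ∫ π, value I.Θ π₀ ∂I.playLaw A t := by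
          refine integral_mono_ae .of_finite .of_finite ?_
          filter_upwards [I.playLaw_feasible T A t] with π hπ
          linarith [hg π hπ]
      _ = value I.Θ π₀ := by simp
  have hsum := Finset.sum_le_sum fun t (_ : t ∈ Finset.univ) => hround t
  rw [Finset.sum_add_distrib, Finset.sum_const, Finset.card_univ, Fintype.card_fin,
    nsmul_eq_mul] at hsum
  have := mul_le_mul_of_nonneg_left hsup (Nat.cast_nonneg (α := ℝ) T)
  linarith

/-! ### Bernoulli instances and the effect of moving one mean. -/

/-- The instance with Bernoulli rewards with the given means, truncated to `[0,1]`. -/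
@[reducible]
def bernoulliInstance (M : Market K) (θ : Matrix (Fin U) (Fin K) ℝ) : Instance U K where
  toMarket := M
  D u k := bernoulliMeasure (1 : ℝ) 0 (Set.projIcc 0 1 zero_le_one (θ u k))
  isProbabilityMeasure _ _ := inferInstance
  support u k := by
    simp [bernoulliMeasure_def, ae_iff, Measure.dirac_apply]

theorem integral_bernoulli {p : ℝ} (hp : p ∈ Set.Icc (0 : ℝ) 1) (f : ℝ → ℝ) :
    ∫ x, f x ∂bernoulliMeasure (1 : ℝ) 0 (Set.projIcc 0 1 zero_le_one p) =
      p * f 1 + (1 - p) * f 0 := by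
  rw [integral_bernoulliMeasure, Set.projIcc_of_mem zero_le_one hp]
  simp

theorem bernoulliInstance_Θ (M : Market K) {θ : Matrix (Fin U) (Fin K) ℝ}
    (hθ : ∀ u k, θ u k ∈ Set.Icc (0 : ℝ) 1) : (bernoulliInstance M θ).Θ = θ := by
  ext u k
  rw [Instance.Θ, integral_bernoulli (hθ u k)]
  simp

/-- The log-likelihood ratio of two Bernoulli distributions. -/
def bernoulliLLR (p q x : ℝ) : ℝ :=
  if x = 1 then Real.log (q / p) else Real.log ((1 - q) / (1 - p))

theorem measurable_bernoulliLLR (p q : ℝ) : Measurable (bernoulliLLR p q) :=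
  Measurable.ite (measurableSet_singleton 1) measurable_const measurable_const

theorem bernoulliMeasure_eq_withDensity {p q : ℝ} (hp : p ∈ Set.Ioo (0 : ℝ) 1)
    (hq : q ∈ Set.Ioo (0 : ℝ) 1) :
    bernoulliMeasure (1 : ℝ) 0 (Set.projIcc 0 1 zero_le_one q) =
      (bernoulliMeasure (1 : ℝ) 0 (Set.projIcc 0 1 zero_le_one p)).withDensity
        fun x => ENNReal.ofReal (Real.exp (bernoulliLLR p q x)) := by
  have hm := (measurable_bernoulliLLR p q).exp.ennreal_ofReal
  have h1 : Real.exp (bernoulliLLR p q 1) = q / p := by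
    rw [bernoulliLLR, if_pos rfl, Real.exp_log (div_pos hq.1 hp.1)]
  have h0 : Real.exp (bernoulliLLR p q 0) = (1 - q) / (1 - p) := by
    rw [bernoulliLLR, if_neg (by norm_num),
      Real.exp_log (div_pos (sub_pos.2 hq.2) (sub_pos.2 hp.2))]
  have key : ∀ {a b : ℝ}, 0 < a → 0 < b → ENNReal.ofReal b =
      ENNReal.ofReal a * ENNReal.ofReal (b / a) := fun ha hb => by
    rw [← ENNReal.ofReal_mul ha.le, mul_div_cancel₀ _ ha.ne']
  have hcoe : ∀ x : unitInterval,
      ((unitInterval.toNNReal x : NNReal) : ℝ≥0∞) = ENNReal.ofReal x := fun x => by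
    rw [ENNReal.ofReal_eq_coe_nnreal x.2.1]
    rfl
  refine Measure.ext_of_lintegral _ fun f hf => ?_
  rw [lintegral_withDensity_eq_lintegral_mul _ hm hf]
  simp only [bernoulliMeasure_def, lintegral_add_measure, lintegral_smul_measure, lintegral_dirac,
    Pi.mul_apply, h1, h0, ENNReal.smul_def, smul_eq_mul, hcoe, unitInterval.coe_symm_eq,
    Set.projIcc_of_mem zero_le_one (Set.Ioo_subset_Icc_self hp),
    Set.projIcc_of_mem zero_le_one (Set.Ioo_subset_Icc_self hq)]
  rw [← mul_assoc, ← mul_assoc, ← key hp.1 hq.1, ← key (sub_pos.2 hp.2) (sub_pos.2 hq.2)]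

/-- Applying log x ≤ x - 1 to both terms bounds the divergence by the chi-square distance, which is
the right-hand side. -/
theorem bernoulli_kl_le {p q : ℝ} (hp : p ∈ Set.Ioo (0 : ℝ) 1) (hq : q ∈ Set.Ioo (0 : ℝ) 1) :
    -∫ x, bernoulliLLR p q x ∂bernoulliMeasure (1 : ℝ) 0 (Set.projIcc 0 1 zero_le_one p) ≤
      (q - p) ^ 2 / (q * (1 - q)) := by
  have hp' := sub_pos.2 hp.2
  have hq' := sub_pos.2 hq.2
  have hlog : ∀ {a b : ℝ}, 0 < a → 0 < b → -Real.log (b / a) ≤ a / b - 1 := fun ha hb => by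
    rw [← Real.log_inv, inv_div]
    exact Real.log_le_sub_one_of_pos (div_pos ha hb)
  have h1 := mul_le_mul_of_nonneg_left (hlog hp.1 hq.1) hp.1.le
  have h0 := mul_le_mul_of_nonneg_left (hlog hp' hq') hp'.le
  rw [integral_bernoulli (Set.Ioo_subset_Icc_self hp), bernoulliLLR, bernoulliLLR, if_pos rfl,
    if_neg (by norm_num)]
  calc _ = p * -Real.log (q / p) + (1 - p) * -Real.log ((1 - q) / (1 - p)) := by ring
    _ ≤ p * (p / q - 1) + (1 - p) * ((1 - p) / (1 - q) - 1) := add_le_add h1 h0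
    _ = (q - p) ^ 2 / (q * (1 - q)) := by
      have := hq.1.ne'
      have := hq'.ne'
      field_simp
      ring

/-- Moving a single mean changes the probability of playing the corresponding arm by an amount
controlled by the expected number of plays of this arm. -/
theorem playLaw_real_le (M : Market K) (A : Policy U M) {θ θ' : Matrix (Fin U) (Fin K) ℝ}
    {u : Fin U} {k : Fin K} (hne : ∀ v l, ¬(v = u ∧ l = k) → θ' v l = θ v l)
    (hp : θ u k ∈ Set.Icc (1 / 4 : ℝ) (3 / 4)) (hq : θ' u k ∈ Set.Icc (1 / 4 : ℝ) (3 / 4))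
    {T : ℕ} (s : Fin T) :
    ((bernoulliInstance M θ').playLaw A s).real {π | π u = k} ≤
      ((bernoulliInstance M θ).playLaw A s).real {π | π u = k} +
        8 * (16 / 3 * (θ' u k - θ u k) ^ 2 *
          ∑ t : Fin T, ((bernoulliInstance M θ).playLaw A t).real {π | π u = k}) + 1 / 8 := by
  have hp' : θ u k ∈ Set.Ioo (0 : ℝ) 1 := ⟨by linarith [hp.1], by linarith [hp.2]⟩
  have hq' : θ' u k ∈ Set.Ioo (0 : ℝ) 1 := ⟨by linarith [hq.1], by linarith [hq.2]⟩
  set I := bernoulliInstance M θ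
  set I' := bernoulliInstance M θ'
  set lr : Fin U → Fin K → ℝ → ℝ := fun v l =>
    if v = u ∧ l = k then bernoulliLLR (θ u k) (θ' u k) else 0 with hlr
  have hlrm : ∀ v l, Measurable (lr v l) := fun v l => by
    simp only [hlr]
    split_ifs
    · exact measurable_bernoulliLLR _ _
    · exact measurable_const
  have hlri : ∀ v l, Integrable (lr v l) (I.D v l) := fun v l =>
    integrable_bernoulliMeasure _ _ _ _
  have hD : ∀ v l, I'.D v l =
      (I.D v l).withDensity fun x => ENNReal.ofReal (Real.exp (lr v l x)) := fun v l => by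
    by_cases h : v = u ∧ l = k
    · obtain ⟨rfl, rfl⟩ := h
      simp only [hlr, and_self, if_true]
      exact bernoulliMeasure_eq_withDensity hp' hq'
    · simp only [hlr, if_neg h, Pi.zero_apply, Real.exp_zero, ENNReal.ofReal_one]
      rw [← Pi.one_def, withDensity_one]
      simp only [I, I', hne v l h]
  have hlaw := I.historyLaw_eq_withDensity I' A A rfl hlrm hD T
  have hE : MeasurableSet {π : Matching U K | π u = k} := (Set.to_countable _).measurableSet
  -- Divergence decomposition: the log-likelihood ratio vanishes unless `u` plays `k`, so the
  -- divergence of the histories is that of one reward times the expected number of such plays. The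
  -- factor 16/3 comes from q(1-q) ≥ 3/16 on [1/4, 3/4].
  have hkl : -∫ h, ∑ t : Fin T, ∑ v, lr v ((h t).1 v) ((h t).2 v) ∂I.historyLaw A T ≤
      16 / 3 * (θ' u k - θ u k) ^ 2 * ∑ t : Fin T, (I.playLaw A t).real {π | π u = k} := by
    have hin : ∀ π : Matching U K, ∑ v, ∫ x, lr v (π v) x ∂I.D v (π v) =
        {π : Matching U K | π u = k}.indicator
          (fun _ => ∫ x, bernoulliLLR (θ u k) (θ' u k) x ∂I.D u k) π := fun π => by
      rw [Finset.sum_eq_single u (fun v _ hv => by simp [hlr, hv]) (by simp)]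
      by_cases hk : π u = k
      · simp [hlr, hk, Set.indicator]
      · simp [hlr, hk, Set.indicator]
    have hb := bernoulli_kl_le hp' hq'
    have hc : (θ' u k - θ u k) ^ 2 / (θ' u k * (1 - θ' u k)) ≤
        16 / 3 * (θ' u k - θ u k) ^ 2 := by
      have : 3 / 16 ≤ θ' u k * (1 - θ' u k) := by nlinarith [hq.1, hq.2]
      rw [div_le_iff₀ (by linarith)]
      nlinarith [sq_nonneg (θ' u k - θ u k)]
    rw [I.integral_history_sum A hlrm hlri]
    simp_rw [hin, integral_indicator_const _ hE, smul_eq_mul]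
    rw [← Finset.sum_mul, ← mul_neg, mul_comm]
    exact mul_le_mul_of_nonneg_right (hb.trans hc)
      (Finset.sum_nonneg fun t _ => measureReal_nonneg)
  have hm : Measurable fun h : History U K T => ∑ t, ∑ v, lr v ((h t).1 v) ((h t).2 v) :=
    Finset.measurable_sum _ fun t _ => (measurable_round_sum hlrm).comp (measurable_pi_apply t)
  have : IsProbabilityMeasure ((I.historyLaw A T).withDensity fun h =>
      ENNReal.ofReal (Real.exp (∑ t, ∑ v, lr v ((h t).1 v) ((h t).2 v)))) := by
    rw [← hlaw]
    infer_instance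
  have hmain := measureReal_withDensity_exp_le hm (I.integrable_history_sum A hlrm hlri)
    (measurable_play s hE)
  rw [← hlaw] at hmain
  rw [Instance.playLaw, Instance.playLaw, map_measureReal_apply (measurable_play s) hE,
    map_measureReal_apply (measurable_play s) hE]
  linarith

/-! ### Averaging over the secret arms. -/

/-- The matrix `θ` with the entry of every user `u ∈ S` at the arm `j u` raised by `ε`. -/
def perturb (θ : Matrix (Fin U) (Fin K) ℝ) (ε : ℝ) (S : Finset (Fin U)) (j : Fin U → Fin K) :
    Matrix (Fin U) (Fin K) ℝ :=
  fun u k => θ u k + if u ∈ S ∧ k = j u then ε else 0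

/-- The map (j, k) ↦ (`update j u k`, `j u`) is an involution of the pairs. This permits averaging
over the secret arm of one user while those of the others are fixed. -/
theorem sum_piFinset_update {Opt : Finset (Fin K)} (u : Fin U) (F : (Fin U → Fin K) → ℝ) :
    ∑ j ∈ Fintype.piFinset (fun _ : Fin U => Opt), ∑ k ∈ Opt, F (Function.update j u k) =
      Opt.card * ∑ j ∈ Fintype.piFinset (fun _ : Fin U => Opt), F j := by
  have hup : ∀ j ∈ Fintype.piFinset (fun _ : Fin U => Opt), ∀ k ∈ Opt,
      Function.update j u k ∈ Fintype.piFinset (fun _ : Fin U => Opt) := fun j hj k hk => by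
    rw [Fintype.mem_piFinset] at hj ⊢
    intro v
    rcases eq_or_ne v u with rfl | hv
    · simpa using hk
    · simpa [hv] using hj v
  rw [← Finset.sum_product', Finset.mul_sum]
  calc _ = ∑ x ∈ Fintype.piFinset (fun _ : Fin U => Opt) ×ˢ Opt, F x.1 := by
        refine Finset.sum_nbij' (fun x => (Function.update x.1 u x.2, x.1 u))
          (fun x => (Function.update x.1 u x.2, x.1 u)) ?_ ?_ ?_ ?_ ?_
        · intro x hx
          rw [Finset.mem_product] at hx ⊢
          exact ⟨hup _ hx.1 _ hx.2, Fintype.mem_piFinset.1 hx.1 u⟩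
        · intro x hx
          rw [Finset.mem_product] at hx ⊢
          exact ⟨hup _ hx.1 _ hx.2, Fintype.mem_piFinset.1 hx.1 u⟩
        · simp
        · simp
        · simp
    _ = _ := by simp [Finset.sum_product]

/-- If one arm per user of `S` is raised by a small amount, no policy identifies these arms. -/
theorem exists_many_mistakes (M : Market K) (A : Policy U M) {θ : Matrix (Fin U) (Fin K) ℝ}
    {ε : ℝ} {S : Finset (Fin U)} {Opt : Finset (Fin K)} {T : ℕ} (hN : 2 ≤ Opt.card) (hε : 0 ≤ ε)
    (hεT : 400 * T * ε ^ 2 ≤ Opt.card)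
    (hθ : ∀ u ∈ S, ∀ k ∈ Opt, 1 / 4 ≤ θ u k ∧ θ u k + ε ≤ 3 / 4) :
    ∃ j : Fin U → Fin K, (∀ u, j u ∈ Opt) ∧ (S.card : ℝ) * T / 4 ≤
      ∑ u ∈ S, ∑ t : Fin T,
        ((bernoulliInstance M (perturb θ ε S j)).playLaw A t).real {π | π u ≠ j u} := by
  set J := Fintype.piFinset fun _ : Fin U => Opt
  set F : Fin U → (Fin U → Fin K) → ℝ := fun u j => ∑ t : Fin T,
    ((bernoulliInstance M (perturb θ ε S j)).playLaw A t).real {π | π u = j u} with hF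
  have hN' : (2 : ℝ) ≤ Opt.card := by exact_mod_cast hN
  have hT0 : (0 : ℝ) ≤ T := Nat.cast_nonneg T
  have hinner : ∀ u ∈ S, ∀ j, ∑ k ∈ Opt, F u (Function.update j u k) ≤
      Opt.card * (3 / 4 * T) := fun u hu j => by
    -- Expected play counts in the reference instance, where `u` has no raised arm. This instance
    -- does not depend on `k`, so the counts for different `k` can be added.
    set n : Fin K → ℝ := fun k => ∑ t : Fin T,
      ((bernoulliInstance M (perturb θ ε (S.erase u) j)).playLaw A t).real {π | π u = k} with hn
    have hle : ∀ k ∈ Opt, F u (Function.update j u k) ≤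
        n k + T * (8 * (16 / 3 * ε ^ 2 * n k) + 1 / 8) := fun k hk => by
      have hp : perturb θ ε (S.erase u) j u k = θ u k := by simp [perturb]
      have hq : perturb θ ε S (Function.update j u k) u k = θ u k + ε := by simp [perturb, hu]
      have hs : ∀ s : Fin T, _ := fun s => playLaw_real_le M A
        (θ := perturb θ ε (S.erase u) j) (θ' := perturb θ ε S (Function.update j u k))
        (u := u) (k := k) (fun v l hvl => by
          rcases eq_or_ne v u with rfl | hv
          · have : l ≠ k := fun h => hvl ⟨rfl, h⟩
            simp [perturb, this]
          · simp [perturb, hv])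
        (by rw [hp]; exact ⟨(hθ u hu k hk).1, by linarith [(hθ u hu k hk).2]⟩)
        (by rw [hq]; exact ⟨by linarith [(hθ u hu k hk).1], (hθ u hu k hk).2⟩) s
      have hsum := Finset.sum_le_sum fun s (_ : s ∈ Finset.univ) => hs s
      simp only [hp, hq, add_sub_cancel_left, Finset.sum_add_distrib, Finset.sum_const,
        Finset.card_univ, Fintype.card_fin, nsmul_eq_mul] at hsum
      simp only [hF, Function.update_self]
      simp only [hn]
      linarith
    have hn1 : ∑ k ∈ Opt, n k ≤ T := by
      simp only [hn]
      rw [Finset.sum_comm]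
      have : ∀ t : Fin T, ∑ k ∈ Opt,
          ((bernoulliInstance M (perturb θ ε (S.erase u) j)).playLaw A t).real
            {π | π u = k} ≤ 1 := fun t => by
        rw [← measureReal_biUnion_finset]
        · exact measureReal_le_one
        · intro k _ l _ hkl
          exact Set.disjoint_left.2 fun π hk hl => hkl (Eq.trans (Eq.symm hk) hl)
        · exact fun k _ => (Set.to_countable _).measurableSet
      calc _ ≤ ∑ _t : Fin T, (1 : ℝ) := Finset.sum_le_sum fun t _ => this t
        _ = T := by simp
    calc ∑ k ∈ Opt, F u (Function.update j u k)
        ≤ ∑ k ∈ Opt, (n k + T * (8 * (16 / 3 * ε ^ 2 * n k) + 1 / 8)) := Finset.sum_le_sum hle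
      _ = ∑ k ∈ Opt, ((1 + T * 8 * (16 / 3) * ε ^ 2) * n k + T / 8) :=
          Finset.sum_congr rfl fun k _ => by ring
      _ = (1 + T * 8 * (16 / 3) * ε ^ 2) * ∑ k ∈ Opt, n k + Opt.card * (T / 8) := by
          rw [Finset.sum_add_distrib, Finset.mul_sum, Finset.sum_const, nsmul_eq_mul]
      -- Here 1 ≤ N/2 as N ≥ 2, and (128/3)Tε² ≤ (128/1200)N by `hεT`. The coefficients 1/2 +
      -- 128/1200 + 1/8 stay below 3/4.
      _ ≤ (Opt.card / 2 + 128 / 1200 * Opt.card) * T + Opt.card * (T / 8) := by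
          refine add_le_add_left (mul_le_mul ?_ hn1
            (Finset.sum_nonneg fun k _ => Finset.sum_nonneg fun t _ => measureReal_nonneg)
            (by positivity)) _
          linarith
      _ ≤ Opt.card * (3 / 4 * T) := by nlinarith [mul_nonneg (Nat.cast_nonneg (α := ℝ) Opt.card) hT0]
  have hsum : ∑ j ∈ J, ∑ u ∈ S, F u j ≤ ∑ _j ∈ J, (S.card : ℝ) * (3 / 4 * T) := by
    rw [Finset.sum_comm]
    have hu : ∀ u ∈ S, ∑ j ∈ J, F u j ≤ J.card * (3 / 4 * T) := fun u hu => by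
      have h1 := sum_piFinset_update (Opt := Opt) u (F u)
      have h2 := Finset.sum_le_sum fun j (_ : j ∈ J) => hinner u hu j
      rw [h1, Finset.sum_const, nsmul_eq_mul, mul_left_comm] at h2
      exact le_of_mul_le_mul_left h2 (by linarith)
    refine (Finset.sum_le_sum hu).trans (le_of_eq ?_)
    simp only [Finset.sum_const, nsmul_eq_mul]
    ring
  have hJ : J.Nonempty := Fintype.piFinset_nonempty.2 fun _ => Finset.card_pos.1 (by lia)
  obtain ⟨j, hj, hle⟩ := Finset.exists_le_of_sum_le hJ hsum
  refine ⟨j, Fintype.mem_piFinset.1 hj, ?_⟩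
  have hcompl : ∀ u, ∑ t : Fin T,
      ((bernoulliInstance M (perturb θ ε S j)).playLaw A t).real {π | π u ≠ j u} =
        T - F u j := fun u => by
    have : ∀ t : Fin T, ((bernoulliInstance M (perturb θ ε S j)).playLaw A t).real
        {π | π u ≠ j u} = 1 - ((bernoulliInstance M (perturb θ ε S j)).playLaw A t).real
          {π | π u = j u} := fun t =>
      probReal_compl_eq_one_sub (s := {π : Matching U K | π u = j u})
        (Set.to_countable _).measurableSet
    simp only [this, Finset.sum_sub_distrib, hF]
    simp
  simp only [hcompl, Finset.sum_sub_distrib, Finset.sum_const, nsmul_eq_mul]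
  linarith

theorem value_perturb (θ : Matrix (Fin U) (Fin K) ℝ) (ε : ℝ) (S : Finset (Fin U))
    (j : Fin U → Fin K) (π : Matching U K) :
    value (perturb θ ε S j) π = value θ π + ε * (S.filter fun u => π u = j u).card := by
  have : S.filter (fun u => π u = j u) = Finset.univ.filter fun u => u ∈ S ∧ π u = j u := by
    ext
    simp
  rw [this]
  simp only [value, perturb, Finset.sum_add_distrib, ← Finset.sum_filter, Finset.sum_const,
    nsmul_eq_mul, mul_comm ε]

/-- A lower bound on the regret when the raised arms are optimal for the users in `S`, so that
every mistake costs `ε`. -/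
theorem exists_le_regret (M : Market K) (A : Policy U M) {θ : Matrix (Fin U) (Fin K) ℝ}
    {ε : ℝ} {S : Finset (Fin U)} {Opt : Finset (Fin K)} {T : ℕ} (hN : 2 ≤ Opt.card) (hε : 0 ≤ ε)
    (hεT : 400 * T * ε ^ 2 ≤ Opt.card)
    (hθ : ∀ u ∈ S, ∀ k ∈ Opt, 1 / 4 ≤ θ u k ∧ θ u k + ε ≤ 3 / 4)
    (h01 : ∀ u k, θ u k ∈ Set.Icc (0 : ℝ) 1)
    (hopt : ∀ j : Fin U → Fin K, (∀ u, j u ∈ Opt) → ∃ π₀ : Matching U K, M.Feasible π₀ ∧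
      (∀ u ∈ S, π₀ u = j u) ∧ ∀ π, M.Feasible π → value θ π ≤ value θ π₀) :
    ∃ j : Fin U → Fin K, (∀ u, j u ∈ Opt) ∧
      (bernoulliInstance M (perturb θ ε S j)).Θ = perturb θ ε S j ∧
      ε * (S.card * T / 4) ≤ (bernoulliInstance M (perturb θ ε S j)).regret A T := by
  obtain ⟨j, hj, hle⟩ := exists_many_mistakes M A (S := S) hN hε hεT hθ
  have hΘ : (bernoulliInstance M (perturb θ ε S j)).Θ = perturb θ ε S j := by
    refine bernoulliInstance_Θ M fun u k => ?_
    unfold perturb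
    split_ifs with h
    · obtain ⟨hu, rfl⟩ := h
      have := hθ u hu _ (hj u)
      exact ⟨by linarith, by linarith⟩
    · simpa using h01 u k
  refine ⟨j, hj, hΘ, ?_⟩
  obtain ⟨π₀, h₀, hj₀, hπ⟩ := hopt j hj
  refine le_trans ?_ ((bernoulliInstance M (perturb θ ε S j)).le_regret A T
    (g := fun π => ε * (S.filter fun u => π u ≠ j u).card) h₀ fun π hf => ?_)
  rotate_left
  · rw [hΘ, value_perturb, value_perturb, Finset.filter_true_of_mem hj₀, add_assoc, ← mul_add,
      ← Nat.cast_add, Finset.card_filter_add_card_filter_not]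
    exact add_le_add_left (hπ π hf) _
  have hint : ∀ t : Fin T, ∫ π, ε * ((S.filter fun u => π u ≠ j u).card : ℝ)
      ∂(bernoulliInstance M (perturb θ ε S j)).playLaw A t =
      ε * ∑ u ∈ S, ((bernoulliInstance M (perturb θ ε S j)).playLaw A t).real
        {π | π u ≠ j u} := fun t => by
    rw [integral_const_mul]
    congr 1
    have : ∀ π : Matching U K, ((S.filter fun u => π u ≠ j u).card : ℝ) =
        ∑ u ∈ S, {π : Matching U K | π u ≠ j u}.indicator 1 π := fun π => by
      simp [Finset.card_filter, Set.indicator_apply]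
    simp_rw [this]
    rw [integral_finsetSum _ fun _ _ => .of_finite]
    exact Finset.sum_congr rfl fun u _ => integral_indicator_one (Set.to_countable _).measurableSet
  simp_rw [hint]
  rw [← Finset.mul_sum, Finset.sum_comm]
  exact mul_le_mul_of_nonneg_left hle hε

/-! ### The size of the gap and the three hard instances. -/

/-- The gap of the hard instances with `N` candidate arms per user. -/
def gap (N T : ℕ) : ℝ := Real.sqrt (N / T) / 20

theorem gap_nonneg (N T : ℕ) : 0 ≤ gap N T := by
  unfold gap
  positivity

theorem gap_sq {N T : ℕ} (hT : 0 < T) : 400 * T * gap N T ^ 2 = N := by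
  have : (0 : ℝ) < T := by exact_mod_cast hT
  rw [gap, div_pow, Real.sq_sqrt (by positivity)]
  field_simp
  ring

theorem gap_mul {N T : ℕ} (hT : 0 < T) (m : ℝ) :
    gap N T * (m * T / 4) = m * Real.sqrt (T * N) / 80 := by
  have h0 : (0 : ℝ) < T := by exact_mod_cast hT
  have : Real.sqrt (N / T) * T = Real.sqrt (T * N) := by
    conv_lhs => rw [← Real.sqrt_sq h0.le, ← Real.sqrt_mul (by positivity)]
    congr 1
    rw [Real.sqrt_sq h0.le]
    field_simp
  rw [← this, gap]
  ring

theorem gap_le {N T : ℕ} (hT : 0 < T) (hN : N ≤ T) : gap N T ≤ 1 / 20 := by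
  have h0 : (0 : ℝ) < T := by exact_mod_cast hT
  have : Real.sqrt (N / T) ≤ 1 := by
    rw [Real.sqrt_le_left one_pos.le, one_pow, div_le_one h0]
    exact_mod_cast hN
  rw [gap]
  linarith

/-- The bound 1/(20K) is the slope of the monotone rows in `knownPeaks_lowerBound_sqrt`. A raise no
larger than the slope keeps such a row monotone, so its peak does not move; this is the role of K³ ≤
T. -/
theorem gap_le_of_pow_three_le {K T : ℕ} (hK : 0 < K) (hT : K ^ 3 ≤ T) :
    gap K T ≤ 1 / (20 * K) := by
  have h0 : (0 : ℝ) < K := by exact_mod_cast hK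
  have h1 : (K : ℝ) ^ 3 ≤ T := by exact_mod_cast hT
  have h2 : (0 : ℝ) < T := lt_of_lt_of_le (by positivity) h1
  have : Real.sqrt (K / T) ≤ 1 / K := by
    rw [Real.sqrt_le_left (by positivity), div_pow, div_le_div_iff₀ h2 (by positivity)]
    nlinarith
  rw [gap]
  calc Real.sqrt (K / T) / 20 ≤ 1 / K / 20 := by gcongr
    _ = 1 / (20 * K) := by field_simp

/-- With unknown peaks and free arms, every user faces an independent bandit problem. -/
theorem unknownPeaks_lowerBound {T : ℕ} (hK : 2 ≤ K) (hKT : K ≤ T)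
    (A : UnknownPeaksAlgorithm U K) :
    UnknownPeaksWorstCaseRegretGE A T (U * Real.sqrt (T * K) / 80) := by
  have hT : 0 < T := by lia
  have hε := gap_le hT hKT
  have hε0 := gap_nonneg K T
  let M : Market K := ⟨fun _ => 0, 0, fun _ => le_rfl⟩
  let θ : Matrix (Fin U) (Fin K) ℝ := fun _ _ => 1 / 2
  obtain ⟨j, -, hΘ, hle⟩ := exists_le_regret M (A M) (θ := θ) (ε := gap K T)
    (S := Finset.univ) (Opt := Finset.univ) (T := T) (by simpa using hK) hε0
    (by simpa using (gap_sq hT).le) (fun _ _ _ _ => ⟨by norm_num [θ], by simp only [θ]; linarith⟩)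
    (fun _ _ => ⟨by norm_num [θ], by norm_num [θ]⟩)
    fun j _ => ⟨j, by simp [Market.Feasible, M], fun _ _ => rfl, fun π _ => le_rfl⟩
  refine ⟨_, ?_, (gap_mul hT U).symm.le.trans (by simpa using hle)⟩
  rw [hΘ]
  refine ⟨j, fun u => ⟨fun a _ b hb hab => ?_, fun a ha b _ hab => ?_⟩⟩
  · by_cases h : a = j u
    · rw [show b = a from (le_antisymm hb (h ▸ hab)).trans h.symm]
    · simp only [perturb, θ, h, and_false, if_false]
      split_ifs <;> linarith
  · by_cases h : b = j u
    · rw [show a = b from (le_antisymm (h ▸ hab) ha).trans h.symm]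
    · simp only [perturb, θ, h, and_false, if_false]
      split_ifs <;> linarith

/-- When a single arm has to serve two users with opposite peaks, whose rewards add up to
a constant, the known peaks are of no help. -/
theorem knownPeaks_lowerBound_sqrt {T : ℕ} (hU : 2 ≤ U) (hK : 2 ≤ K) (hKT : K ^ 3 ≤ T)
    (A : KnownPeaksAlgorithm U K) :
    KnownPeaksWorstCaseRegretGE A T (Real.sqrt (T * K) / 80) := by
  have hT : 0 < T := lt_of_lt_of_le (by positivity) hKT
  have hK0 : (0 : ℝ) < K := by exact_mod_cast (by lia : 0 < K)
  have hε := gap_le_of_pow_three_le (by lia) hKT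
  have hε0 := gap_nonneg K T
  set δ : ℝ := 1 / (20 * K) with hδ
  have hδ0 : 0 < δ := by positivity
  have hKδ : K * δ = 1 / 20 := by
    rw [hδ]
    field_simp
  let M : Market K := ⟨fun _ => 1, 1, fun _ => le_rfl⟩
  let u₀ : Fin U := ⟨0, by lia⟩
  let u₁ : Fin U := ⟨1, by lia⟩
  have hne : u₁ ≠ u₀ := by simp [u₀, u₁]
  let θ : Matrix (Fin U) (Fin K) ℝ := fun u k =>
    if u = u₀ then 1 / 4 + (K - k) * δ else if u = u₁ then 1 / 4 + k * δ else 0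
  -- Users other than `u₀` and `u₁` have zero rows, for which any index is a peak.
  let p : Fin U → Fin K := fun u => if u = u₀ then ⟨0, by lia⟩ else ⟨K - 1, by lia⟩
  have hk : ∀ k : Fin K, (0 : ℝ) ≤ k * δ ∧ (k : ℝ) * δ + δ ≤ K * δ := fun k => by
    have : (k : ℝ) + 1 ≤ K := by exact_mod_cast k.2
    exact ⟨by positivity, by nlinarith⟩
  -- Feasible matchings are constant here, so all of them have the same base value and only the
  -- raise for `u₀` distinguishes them.
  have hconst : ∀ a : Fin K, ∑ u, θ u a = 1 / 2 + 1 / 20 := fun a => by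
    rw [Fintype.sum_eq_add u₀ u₁ hne.symm fun u hu => by simp [θ, hu.1, hu.2]]
    simp only [θ, if_true, if_neg hne]
    linarith
  obtain ⟨j, -, hΘ, hle⟩ := exists_le_regret M (A M p) (θ := θ) (ε := gap K T)
    (S := {u₀}) (Opt := Finset.univ) (T := T) (by simpa using hK) hε0
    (by simpa using (gap_sq hT).le)
    (fun u hu k _ => by
      rw [Finset.mem_singleton.1 hu]
      simp only [θ, if_true]
      have := hk k
      exact ⟨by linarith, by linarith⟩)
    (fun u k => by
      have := hk k
      simp only [θ]
      split_ifs
      · exact ⟨by linarith, by linarith⟩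
      · exact ⟨by linarith, by linarith⟩
      · simp)
    fun j _ => by
      have : NeZero U := ⟨by lia⟩
      refine ⟨fun _ => j u₀, ?_, by simp, fun π hπ => ?_⟩
      · simp [Market.Feasible, M, Finset.image_const]
      · have hcard : (Finset.univ.image π).card ≤ 1 := by
          simpa [Market.Feasible, M] using hπ
        have hπc : ∀ u, π u = π u₀ := fun u =>
          Finset.card_le_one.1 hcard _ (by simp) _ (by simp)
        simp only [value]
        rw [Finset.sum_congr rfl fun u _ => by rw [hπc u], hconst, hconst]
  refine ⟨_, p, ?_, le_trans (le_of_eq ?_) hle⟩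
  · rw [hΘ]
    intro u
    by_cases h0 : u = u₀
    · subst h0
      refine ⟨fun a ha b hb hab => ?_, fun a _ b _ hab => ?_⟩
      · have hp : p u₀ = ⟨0, by lia⟩ := by simp [p]
        rw [hp, Set.mem_Iic, Fin.le_def] at ha hb
        have : a = b := Fin.ext (by simp at ha hb; lia)
        rw [this]
      · rcases hab.eq_or_lt with rfl | hlt
        · exact le_rfl
        · have h1 : (a : ℝ) + 1 ≤ b := by exact_mod_cast hlt
          simp only [perturb, θ, if_true, Finset.mem_singleton, true_and]
          split_ifs <;> nlinarith
    · refine ⟨fun a _ b _ hab => ?_, fun a ha b hb hab => ?_⟩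
      · have h1 : (a : ℝ) ≤ b := by exact_mod_cast hab
        simp only [perturb, θ, h0, if_false, Finset.mem_singleton, false_and]
        split_ifs
        · nlinarith
        · rfl
      · have hp : p u = ⟨K - 1, by lia⟩ := by simp [p, h0]
        rw [hp, Set.mem_Ici, Fin.le_def] at ha hb
        have : a = b := Fin.ext (by simp at ha hb; lia)
        rw [this]
  · simpa using (gap_mul (N := K) hT 1).symm

/-- When half of the users are held to a pair of cheap arms on both sides of the peak of the
other half, every user of the latter faces an independent two-armed bandit problem. -/
theorem knownPeaks_lowerBound_mul_sqrt {T : ℕ} (hU : 2 ≤ U) (hK : 3 ≤ K) (hKT : K ≤ T)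
    (A : KnownPeaksAlgorithm U K) :
    KnownPeaksWorstCaseRegretGE A T (U * Real.sqrt T / 240) := by
  have hT : 0 < T := by lia
  have hε := gap_le (N := 2) hT (by lia)
  have hε0 := gap_nonneg 2 T
  let k₀ : Fin K := ⟨0, by lia⟩
  let k₁ : Fin K := ⟨1, by lia⟩
  let k₂ : Fin K := ⟨2, by lia⟩
  have h01 : k₀ ≠ k₁ := by simp [k₀, k₁]
  have h02 : k₀ ≠ k₂ := by simp [k₀, k₂]
  have h12 : k₁ ≠ k₂ := by simp [k₁, k₂]
  -- The budget pays for both cheap arms `k₀` and `k₂`, or for one other arm, which then has to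
  -- serve every user.
  let M : Market K := ⟨fun k => if k = k₀ ∨ k = k₂ then 1 else 2, 2, fun k => by split_ifs <;> simp⟩
  let S : Finset (Fin U) := Finset.univ.filter fun u => (u : ℕ) < U / 2
  have hS : S.card = U / 2 := by
    simp only [S]
    rw [Fin.card_filter_val_lt]
    lia
  -- Raising `k₀` or `k₂` for a user of `S` produces a tie with `k₁`, so `k₁` is a peak in either
  -- case. The users outside `S` value only `k₀`, which makes leaving the cheap pair unprofitable.
  let θ : Matrix (Fin U) (Fin K) ℝ := fun u k =>
    if u ∈ S then if k = k₁ then 1 / 2 + gap 2 T else if k = k₀ ∨ k = k₂ then 1 / 2 else 0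
    else if k = k₀ then 1 else 0
  let p : Fin U → Fin K := fun u => if u ∈ S then k₁ else k₀
  have hOpt : ({k₀, k₂} : Finset (Fin K)).card = 2 := Finset.card_pair h02
  have hcheap : ∀ k ∈ ({k₀, k₂} : Finset (Fin K)), k ≠ k₁ ∧ (k = k₀ ∨ k = k₂) := fun k hk => by
    rcases Finset.mem_insert.1 hk with rfl | hk
    · exact ⟨h01, .inl rfl⟩
    · rw [Finset.mem_singleton.1 hk]
      exact ⟨h12.symm, .inr rfl⟩
  obtain ⟨j, hj, hΘ, hle⟩ := exists_le_regret M (A M p) (θ := θ) (ε := gap 2 T)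
    (S := S) (Opt := {k₀, k₂}) (T := T) hOpt.ge hε0
    (by rw [hOpt]; exact (gap_sq hT).le)
    (fun u hu k hk => by
      simp only [θ, if_pos hu, if_neg (hcheap k hk).1, if_pos (hcheap k hk).2]
      exact ⟨by norm_num, by linarith⟩)
    (fun u k => by
      simp only [θ]
      split_ifs <;> exact ⟨by linarith, by linarith⟩)
    fun j hj => by
      refine ⟨fun u => if u ∈ S then j u else k₀, ?_, fun u hu => if_pos hu, fun π hπ => ?_⟩
      · have hsub : Finset.univ.image (fun u => if u ∈ S then j u else k₀) ⊆ {k₀, k₂} := by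
          intro k hk
          obtain ⟨u, -, rfl⟩ := Finset.mem_image.1 hk
          split_ifs
          · exact hj u
          · simp
        refine (Finset.sum_le_sum_of_subset hsub).trans ?_
        simp [M, Finset.sum_pair h02]
      · have hval : value θ (fun u => if u ∈ S then j u else k₀) =
            ∑ u, if u ∈ S then (1 / 2 : ℝ) else 1 := by
          refine Finset.sum_congr rfl fun u _ => ?_
          by_cases hu : u ∈ S
          · simp only [θ, if_pos hu, if_neg (hcheap _ (hj u)).1, if_pos (hcheap _ (hj u)).2]
          · simp only [θ, if_neg hu, if_true]
        rw [hval]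
        by_cases hall : ∀ u, π u = k₀ ∨ π u = k₂
        · refine Finset.sum_le_sum fun u _ => ?_
          have hne : π u ≠ k₁ := by
            rcases hall u with h | h <;> rw [h]
            exacts [h01, h12.symm]
          by_cases hu : u ∈ S
          · simp only [θ, if_pos hu, if_neg hne, if_pos (hall u), le_refl]
          · simp only [θ, if_neg hu]
            split_ifs <;> norm_num
        · push Not at hall
          obtain ⟨v, hv⟩ := hall
          -- An arm of cost 2 exhausts the budget, so a second arm in the image is impossible.
          have hconst : ∀ u, π u = π v := fun u => by
            by_contra hne
            have hsub : ({π u, π v} : Finset (Fin K)) ⊆ Finset.univ.image π := by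
              simp [Finset.insert_subset_iff]
            have h1 := (Finset.sum_le_sum_of_subset (f := M.cost) hsub).trans hπ
            have h2 : 1 ≤ M.cost (π u) := by
              simp only [M]
              split_ifs <;> simp
            have h3 : M.cost (π v) = 2 := by simp [M, hv.1, hv.2]
            rw [Finset.sum_pair hne, h3] at h1
            simp only [M] at h1 h2
            lia
          have hle : value θ π ≤ ∑ u, if u ∈ S then 1 / 2 + gap 2 T else 0 := by
            refine Finset.sum_le_sum fun u _ => ?_
            rw [hconst u]
            by_cases hu : u ∈ S
            · simp only [θ, if_pos hu]
              split_ifs <;> linarith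
            · simp only [θ, if_neg hu, if_neg hv.1, le_refl]
          refine hle.trans ?_
          have h1 : ∑ u, (if u ∈ S then 1 / 2 + gap 2 T else 0) =
              (U / 2 : ℕ) * (1 / 2 + gap 2 T) := by
            rw [← Finset.sum_filter, Finset.filter_mem_eq_inter, Finset.univ_inter,
              Finset.sum_const, hS, nsmul_eq_mul]
          have h2 : ∑ u, (if u ∈ S then (1 / 2 : ℝ) else 1) = U - (U / 2 : ℕ) * (1 / 2) := by
            have : ∀ u, (if u ∈ S then (1 / 2 : ℝ) else 1) = 1 - if u ∈ S then 1 / 2 else 0 :=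
              fun u => by split_ifs <;> norm_num
            rw [Finset.sum_congr rfl fun u _ => this u, Finset.sum_sub_distrib,
              ← Finset.sum_filter, Finset.filter_mem_eq_inter, Finset.univ_inter,
              Finset.sum_const, Finset.sum_const, hS, nsmul_eq_mul]
            simp
          -- With m = ⌊U/2⌋ the claim is m(1/2 + ε) ≤ U - m/2, that is m(1 + ε) ≤ U, which follows
          -- from ε ≤ 1 and 2m ≤ U.
          have h3 : ((U / 2 : ℕ) : ℝ) * 2 ≤ U := by exact_mod_cast Nat.div_mul_le_self U 2
          have h4 : (0 : ℝ) ≤ (U / 2 : ℕ) := Nat.cast_nonneg _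
          rw [h1, h2]
          nlinarith
  refine ⟨_, p, ?_, le_trans ?_ hle⟩
  · rw [hΘ]
    intro u
    have hju := hcheap _ (hj u)
    by_cases hu : u ∈ S
    · have hrow : ∀ k : Fin K, perturb θ (gap 2 T) S j u k =
          (if k = k₁ then 1 / 2 + gap 2 T else if k = k₀ ∨ k = k₂ then 1 / 2 else 0) +
            if k = j u then gap 2 T else 0 := fun k => by simp [perturb, θ, hu]
      have hp : p u = k₁ := if_pos hu
      have hle1 : ∀ k, perturb θ (gap 2 T) S j u k ≤ 1 / 2 + gap 2 T := fun k => by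
        rw [hrow]
        by_cases h1 : k = k₁
        · simp [h1, hju.1.symm]
        · rw [if_neg h1]
          split_ifs <;> linarith
      have heq1 : perturb θ (gap 2 T) S j u k₁ = 1 / 2 + gap 2 T := by
        simp [hrow, hju.1.symm]
      have hnonneg : ∀ k, 0 ≤ perturb θ (gap 2 T) S j u k := fun k => by
        rw [hrow]
        split_ifs <;> linarith
      rw [hp]
      refine ⟨fun a ha b hb hab => ?_, fun a ha b hb hab => ?_⟩
      · rcases hab.eq_or_lt with rfl | hlt
        · exact le_rfl
        · have : b = k₁ := by
            simp only [Set.mem_Iic, Fin.le_def, Fin.lt_def, k₁] at ha hb hlt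
            exact Fin.ext (by simp only [k₁]; lia)
          rw [this, heq1]
          exact hle1 a
      · rcases hab.eq_or_lt with rfl | hlt
        · exact le_rfl
        · by_cases ha1 : a = k₁
          · rw [ha1, heq1]
            exact hle1 b
          · have hb0 : perturb θ (gap 2 T) S j u b = 0 := by
              have hb3 : 3 ≤ (b : ℕ) := by
                have : (a : ℕ) ≠ 1 := fun h => ha1 (Fin.ext h)
                simp only [Set.mem_Ici, Fin.le_def, Fin.lt_def, k₁] at ha hlt
                lia
              have hb' : b ≠ k₀ ∧ b ≠ k₁ ∧ b ≠ k₂ := by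
                refine ⟨?_, ?_, ?_⟩ <;> rintro rfl <;> simp [k₀, k₁, k₂] at hb3
              have hbj : b ≠ j u := by
                rcases hju.2 with h | h <;> rw [h]
                exacts [hb'.1, hb'.2.2]
              simp [hrow, hb', hbj]
            rw [hb0]
            exact hnonneg a
    · have hrow : ∀ k : Fin K, perturb θ (gap 2 T) S j u k = if k = k₀ then 1 else 0 :=
        fun k => by simp [perturb, θ, hu]
      have hp : p u = k₀ := if_neg hu
      rw [hp]
      refine ⟨fun a ha b hb hab => ?_, fun a ha b hb hab => ?_⟩
      · have : a = b := by
          simp only [Set.mem_Iic, Fin.le_def, k₀] at ha hb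
          exact Fin.ext (by lia)
        rw [this]
      · rw [hrow, hrow]
        have : b = k₀ → a = k₀ := fun h => le_antisymm (h ▸ hab) ha
        split_ifs with hb0 ha0 <;> simp_all
  · rw [hS, gap_mul hT]
    -- ⌊U/2⌋ ≥ U/3 because U ≥ 2; this loss turns the constant 1/80 into 1/240.
    have h3 : (U : ℝ) ≤ 3 * (U / 2 : ℕ) := by exact_mod_cast (by lia : U ≤ 3 * (U / 2))
    have h4 : Real.sqrt T ≤ Real.sqrt (T * (2 : ℕ)) := by
      refine Real.sqrt_le_sqrt ?_
      have : (0 : ℝ) ≤ T := Nat.cast_nonneg T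
      push_cast
      linarith
    have := mul_le_mul h3 h4 (Real.sqrt_nonneg _) (by positivity)
    linarith

end CBR

end

theorem mainTheorem4 :
    ∃ c : ℝ, 0 < c ∧
      -- known peaks
      (∀ U K T : ℕ, 2 ≤ U → 2 ≤ K → U ≤ T → K ≤ T → ∀ A : CBR.KnownPeaksAlgorithm U K,
        (3 ≤ K → K ^ 3 ≤ T →
          CBR.KnownPeaksWorstCaseRegretGE A T
            (c * max ((U : ℝ) * Real.sqrt T) (Real.sqrt ((T : ℝ) * K)))) ∧
        (3 ≤ K → CBR.KnownPeaksWorstCaseRegretGE A T (c * ((U : ℝ) * Real.sqrt T))) ∧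
        (K ^ 3 ≤ T → CBR.KnownPeaksWorstCaseRegretGE A T (c * Real.sqrt ((T : ℝ) * K)))) ∧
      -- unknown peaks
      (∀ U K T : ℕ, 1 ≤ U → 2 ≤ K → U ≤ T → K ≤ T → ∀ A : CBR.UnknownPeaksAlgorithm U K,
        CBR.UnknownPeaksWorstCaseRegretGE A T (c * ((U : ℝ) * Real.sqrt ((T : ℝ) * K)))) := by
  refine ⟨1 / 240, by norm_num, fun U K T hU hK _ hKT A => ?_,
    fun U K T _ hK _ hKT A => ?_⟩
  · have h1 : 3 ≤ K → CBR.KnownPeaksWorstCaseRegretGE A T (1 / 240 * ((U : ℝ) * Real.sqrt T)) := by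
      intro h
      obtain ⟨I, p, hp, hle⟩ := CBR.knownPeaks_lowerBound_mul_sqrt hU h hKT A
      exact ⟨I, p, hp, by linarith⟩
    have h2 : K ^ 3 ≤ T → CBR.KnownPeaksWorstCaseRegretGE A T
        (1 / 240 * Real.sqrt ((T : ℝ) * K)) := by
      intro h
      obtain ⟨I, p, hp, hle⟩ := CBR.knownPeaks_lowerBound_sqrt hU hK h A
      exact ⟨I, p, hp, by linarith [Real.sqrt_nonneg ((T : ℝ) * K)]⟩
    refine ⟨fun h h' => ?_, h1, h2⟩
    rcases max_choice ((U : ℝ) * Real.sqrt T) (Real.sqrt ((T : ℝ) * K)) with hm | hm <;> rw [hm]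
    exacts [h1 h, h2 h']
  · obtain ⟨I, hI, hle⟩ := CBR.unknownPeaks_lowerBound hK hKT A
    refine ⟨I, hI, ?_⟩
    have : 0 ≤ (U : ℝ) * Real.sqrt ((T : ℝ) * K) := by positivity
    linarith
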